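/- Let $(W,S)$ be a Coxeter system with $W$ finite, with length function $l$ and with $m(r,s)$ the order of $rs$ for $r,s\in S$. Order $W$ by the right weak order, whose covering relations are $ws\lessdot w$ for $w\in W$ and $s\in S$ with $l(ws)<l(w)$; since $W$ is finite this is a lattice. An element $\gamma$ is join-irreducible if it covers exactly one element, which is then denoted $\gamma_*$. The degree of $w\in W$ is the number of generators appearing in a reduced word for $w$. For $K\subseteq S$ let $(w_0)_K$ be the longest element of the subgroup generated by $K$, and let $w_0=(w_0)_S$. A congruence is an equivalence relation on $W$ that respects joins and meets; it contracts an element $y$ if $x\equiv y$ for some $x\lessdot y$. Let $\Theta$ be a congruence of the weak order, and let $\alpha(w)=ww_0$. Let $\alpha(\Theta)$ be the relation defined by $\alpha(x)\equiv\alpha(y) \bmod \alpha(\Theta)$ if and only if $x\equiv y \bmod \Theta$. Then $\alpha(\Theta)$ is a congruence of the weak order, and the following hold. 1. A join-irreducible $s$ of degree one is contracted by $\Theta$ if and only if it is contracted by $\alpha(\Theta)$. 2. Let $\gamma$ be a join-irreducible of degree two with a reduced word of the form $srs\cdots$ (alternating in $s,r\in S$ and starting with $s$). Then $\gamma':=\gamma_*\cdot(w_0)_{\{r,s\}}$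 is a join-irreducible of degree two, it has a reduced word of the form $rsr\cdots$ (alternating and starting with $r$), its length is $l(\gamma')=m(r,s)-l(\gamma)+1$, and $\gamma$ is contracted by $\Theta$ if and only if $\gamma'$ is contracted by $\alpha(\Theta)$. -/

import Mathlib

namespace CoxeterSystem

variable {B W : Type*} [Group W] {M : CoxeterMatrix B} (cs : CoxeterSystem M W)

/-- The generating relations of the right weak order: `w * s` lies below `w` whenever `s` is a
right descent of `w`. -/
def WeakStep (u w : W) : Prop :=
  ∃ i : B, cs.IsRightDescent w i ∧ u = w * cs.simple i

theorem length_le_of_weakSteps {u w : W} (h : Relation.ReflTransGen cs.WeakStep u w) :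
    u = w ∨ cs.length u < cs.length w := by
  induction h with
  | refl => exact Or.inl rfl
  | tail _ hstep ih =>
    obtain ⟨i, hi, rfl⟩ := hstep
    have hlt : cs.length (_ * cs.simple i) < cs.length _ := hi
    rcases ih with rfl | ih
    · exact Or.inr hlt
    · exact Or.inr (ih.trans hlt)

/-- The (right) weak order on `W`. -/
@[reducible]
def weakOrder : PartialOrder W where
  le := Relation.ReflTransGen cs.WeakStep
  le_refl _ := Relation.ReflTransGen.refl
  le_trans _ _ _ := Relation.ReflTransGen.trans
  le_antisymm u w h₁ h₂ := by
    rcases cs.length_le_of_weakSteps h₁ with h | h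
    · exact h
    · rcases cs.length_le_of_weakSteps h₂ with h' | h'
      · exact h'.symm
      · exact absurd (h.trans h') (lt_irrefl _)

/-- `u` is covered by `w` in the weak order. -/
def WeakCovBy (u w : W) : Prop :=
  letI := cs.weakOrder
  u ⋖ w

/-- `j` is the join of `a` and `b` in the weak order. -/
def IsWeakJoin (a b j : W) : Prop :=
  letI := cs.weakOrder
  IsLUB {a, b} j

/-- `m` is the meet of `a` and `b` in the weak order. -/
def IsWeakMeet (a b m : W) : Prop :=
  letI := cs.weakOrder
  IsGLB {a, b} m

/-- A congruence of the weak order: an equivalence relation such that `a₁ ≡ a₂` and `b₁ ≡ b₂` imply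
`a₁ ∨ b₁ ≡ a₂ ∨ b₂` and `a₁ ∧ b₁ ≡ a₂ ∧ b₂`. Joins and meets are expressed as least upper and
greatest lower bounds; for finite `W` the weak order is a lattice, so that they always exist. -/
structure IsWeakCongruence (Θ : Setoid W) : Prop where
  join : ∀ a₁ a₂ b₁ b₂ j₁ j₂ : W, Θ a₁ a₂ → Θ b₁ b₂ →
    cs.IsWeakJoin a₁ b₁ j₁ → cs.IsWeakJoin a₂ b₂ j₂ → Θ j₁ j₂
  meet : ∀ a₁ a₂ b₁ b₂ m₁ m₂ : W, Θ a₁ a₂ → Θ b₁ b₂ →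
    cs.IsWeakMeet a₁ b₁ m₁ → cs.IsWeakMeet a₂ b₂ m₂ → Θ m₁ m₂

/-- `Θ` contracts `w` if it contracts some edge `u ⋖ w`, that is, `u ≡ w` for some `u ⋖ w`. -/
def Contracts (Θ : Setoid W) (w : W) : Prop :=
  ∃ u, cs.WeakCovBy u w ∧ Θ u w

/-- `γ` is join-irreducible: it covers exactly one element. -/
def WeakJoinIrreducible (γ : W) : Prop :=
  ∃! u, cs.WeakCovBy u γ

/-- The unique element `γ_*` covered by a join-irreducible `γ`. -/
noncomputable def lowerCover (γ : W) (hγ : cs.WeakJoinIrreducible γ) : W :=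
  hγ.choose

theorem lowerCover_weakCovBy (γ : W) (hγ : cs.WeakJoinIrreducible γ) :
    cs.WeakCovBy (cs.lowerCover γ hγ) γ :=
  hγ.choose_spec.1

/-- The set of (indices of) generators appearing in a reduced word for `w`. -/
def support (w : W) : Set B :=
  {i | ∃ ω : List B, cs.IsReduced ω ∧ cs.wordProd ω = w ∧ i ∈ ω}

/-- The number of generators in the support of `w`. -/
noncomputable def degree (w : W) : ℕ :=
  (cs.support w).ncard

/-- The parabolic subgroup `W_K`. -/
def parabolic (K : Set B) : Subgroup W :=
  Subgroup.closure (cs.simple '' K)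

theorem exists_longest [Finite W] (K : Set B) :
    ∃ w ∈ cs.parabolic K, ∀ v ∈ cs.parabolic K, cs.length v ≤ cs.length w :=
  (Set.toFinite (cs.parabolic K : Set W)).exists_maximalFor cs.length _
    ⟨1, (cs.parabolic K).one_mem⟩ |>.imp fun w hw =>
      ⟨hw.1, fun v hv => (le_total (cs.length v) (cs.length w)).elim id (hw.2 hv)⟩

/-- The element `(w₀)_K` of maximal length of the parabolic subgroup `W_K`. -/
noncomputable def longestIn [Finite W] (K : Set B) : W :=
  (cs.exists_longest K).choose

theorem longestIn_spec [Finite W] (K : Set B) :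
    cs.longestIn K ∈ cs.parabolic K ∧
      ∀ v ∈ cs.parabolic K, cs.length v ≤ cs.length (cs.longestIn K) :=
  (cs.exists_longest K).choose_spec

/-- The element `w₀` of maximal length of `W`. -/
noncomputable def longest [Finite W] : W :=
  cs.longestIn Set.univ

theorem length_le_length_longest [Finite W] (w : W) : cs.length w ≤ cs.length cs.longest :=
  (cs.longestIn_spec Set.univ).2 w (by
    simp [parabolic, Set.image_univ, cs.subgroup_closure_range_simple])

/-- The antipodal relation `α(Θ)`, where `α(w) = w * w₀`. -/
noncomputable def antipodal [Finite W] (Θ : Setoid W) : Setoid W :=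
  Setoid.comap (fun w => w * cs.longest⁻¹) Θ

/-- `α(x) ≡ α(y)` modulo `α(Θ)` if and only if `x ≡ y` modulo `Θ`. -/
theorem antipodal_iff [Finite W] (Θ : Setoid W) (x y : W) :
    cs.antipodal Θ (x * cs.longest) (y * cs.longest) ↔ Θ x y := by
  change Θ (x * cs.longest * cs.longest⁻¹) (y * cs.longest * cs.longest⁻¹) ↔ Θ x y
  rw [mul_inv_cancel_right, mul_inv_cancel_right]

end CoxeterSystem

/-- The alternating word `a b a ⋯` with `k` letters, whose first letter is `a`. -/
def alternatingFrom {B : Type*} (a b : B) : ℕ → List B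
  | 0 => []
  | k + 1 => a :: alternatingFrom b a k

namespace CoxeterSystem

variable {B W : Type*} [Group W] {M : CoxeterMatrix B} (cs : CoxeterSystem M W)

/-! ### The inversion cocycle and the strong exchange property -/

/-! Fix `K` and put `x = (w₀)_K w₀`. Lengths add in `g x` for `g ∈ W_K`, and the elements above `x`
are exactly `W_K x`. Hence joining with `x` sends `g` to `g x`, and meeting with `(w₀)_K` sends `g
x` back to `g`, so a congruence identifies `g, h` iff it identifies `g x, h x`. By definition `α(Θ)`
relates `g (w₀)_K` and `h (w₀)_K` iff `Θ` relates `g x` and `h x`. So on `W_K` the relation `α(Θ)`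
is `Θ` carried along by right multiplication by `(w₀)_K`: this is
`IsWeakCongruence.antipodal_mul_longestIn_iff`.

For `K = {s}` this multiplication swaps `1` and `s`. For `K = {r, s}` it turns the edge of the chain
`s, sr, srs, …` with lengths `j, j + 1` upside down into the edge of the chain `r, rs, …` with
lengths `m - j - 1, m - j`.

Two general facts support this. Strong exchange, from a parity cocycle counting inversions, gives
the lengths of `w (w₀)_K`. The geometric representation shows that `s_i s_j` has order exactly `M i
j`, so alternating words of length at most `M i j` are reduced. -/

open Classical in
/-- The involution of `W × ℤ/2` that conjugates the first coordinate by a simple reflection `s` and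
flips the second coordinate over `s`. -/
noncomputable def inversionPerm (i : B) : Equiv.Perm (W × ZMod 2) :=
  Function.Involutive.toPerm
    (fun x => (cs.simple i * x.1 * cs.simple i, x.2 + if x.1 = cs.simple i then 1 else 0))
    (by
      rintro ⟨t, ε⟩
      have h : cs.simple i * t * cs.simple i = cs.simple i ↔ t = cs.simple i := by
        rw [mul_assoc, mul_eq_left, mul_eq_one_iff_eq_inv, inv_simple]
      have h2 : (1 + 1 : ZMod 2) = 0 := by decide
      by_cases ht : t = cs.simple i
      · simp [ht, add_assoc, h2]
      · simp only [h, if_neg ht, add_zero]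
        simp [mul_assoc])

open Classical in
theorem inversionPerm_apply (i : B) (t : W) (ε : ZMod 2) :
    cs.inversionPerm i (t, ε) =
      (cs.simple i * t * cs.simple i, ε + if t = cs.simple i then 1 else 0) := rfl

open Classical in
theorem inversionPerm_mul_pow_apply (i j : B) (n : ℕ) (t : W) (ε : ZMod 2) :
    ((cs.inversionPerm i * cs.inversionPerm j) ^ n) (t, ε) =
      ((cs.simple i * cs.simple j) ^ n * t * ((cs.simple i * cs.simple j) ^ n)⁻¹,
        ε + ∑ k ∈ Finset.range (2 * n),
          if t = cs.simple j * (cs.simple i * cs.simple j) ^ k then 1 else 0) := by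
  induction n with
  | zero => simp
  | succ n ih =>
    rw [pow_succ', Equiv.Perm.mul_apply, ih, Equiv.Perm.mul_apply, inversionPerm_apply,
      inversionPerm_apply, show 2 * (n + 1) = 2 * n + 1 + 1 by ring, Finset.sum_range_succ,
      Finset.sum_range_succ]
    set p := cs.simple i * cs.simple j with hp
    have hconj : cs.simple j * p ^ n = (p ^ n)⁻¹ * cs.simple j := by
      have h : SemiconjBy (cs.simple j) p p⁻¹ := by
        simp [SemiconjBy, hp, mul_assoc]
      rw [← inv_pow]
      exact h.pow_right n
    have h1 : p ^ n * t * (p ^ n)⁻¹ = cs.simple j ↔ t = cs.simple j * p ^ (2 * n) := by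
      rw [two_mul, pow_add, ← mul_assoc, hconj, mul_inv_eq_iff_eq_mul, ← eq_inv_mul_iff_mul_eq,
        mul_assoc]
    have h2 : cs.simple j * (p ^ n * t * (p ^ n)⁻¹) * cs.simple j = cs.simple i ↔
        t = cs.simple j * p ^ (2 * n + 1) := by
      have e1 : cs.simple j * p ^ (2 * n + 1) = (p ^ n)⁻¹ * cs.simple j * p * p ^ n := by
        rw [← hconj, mul_assoc, mul_assoc, ← pow_succ', ← pow_add]
        congr 2; ring
      have e2 : cs.simple i = p * cs.simple j := by simp [hp]
      rw [e1, e2, mul_left_inj, ← eq_inv_mul_iff_mul_eq, mul_inv_eq_iff_eq_mul,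
        ← eq_inv_mul_iff_mul_eq, inv_simple]
      simp only [mul_assoc]
    refine Prod.ext ?_ ?_
    · simp only [hp, pow_succ', mul_inv_rev, inv_simple, mul_assoc]
    · simp only [h1, h2, add_assoc]

/-- At `n = M i j` the terms `k` and `k + M i j` of the sum agree, so the `ℤ/2` coordinate is
unchanged. -/
theorem isLiftable_inversionPerm : M.IsLiftable cs.inversionPerm := by
  classical
  intro i j
  ext1 ⟨t, ε⟩
  rw [inversionPerm_mul_pow_apply, cs.simple_mul_simple_pow, two_mul, Finset.sum_range_add]
  simp only [pow_add, simple_mul_simple_pow, one_mul, mul_one, inv_one, Equiv.Perm.one_apply]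
  rw [CharTwo.add_self_eq_zero, add_zero]

/-- The action of `W` on `W × ℤ/2` that lifts conjugation by recording the parity of inversions. -/
noncomputable def inversionAction : W →* Equiv.Perm (W × ZMod 2) :=
  cs.lift ⟨cs.inversionPerm, cs.isLiftable_inversionPerm⟩

open Classical in
theorem inversionAction_wordProd (ω : List B) (t : W) (ε : ZMod 2) :
    cs.inversionAction (cs.wordProd ω) (t, ε) =
      (cs.wordProd ω * t * (cs.wordProd ω)⁻¹, ε + ((cs.rightInvSeq ω).count t : ZMod 2)) := by
  induction ω with
  | nil => simp
  | cons i ω ih =>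
    rw [wordProd_cons, map_mul, Equiv.Perm.mul_apply, ih, inversionAction, lift_apply_simple,
      inversionPerm_apply, rightInvSeq, List.count_cons]
    have h : cs.wordProd ω * t * (cs.wordProd ω)⁻¹ = cs.simple i ↔
        (cs.wordProd ω)⁻¹ * cs.simple i * cs.wordProd ω = t := by
      rw [mul_inv_eq_iff_eq_mul, ← eq_inv_mul_iff_mul_eq, mul_assoc, eq_comm]
    refine Prod.ext ?_ ?_
    · simp [mul_assoc]
    · simp [h, add_assoc]

/-- The parity of the number of occurrences of `t` in the inversion sequence of any word for `w`. -/
noncomputable def inversionParity (w t : W) : ZMod 2 := (cs.inversionAction w (t, 0)).2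

open Classical in
theorem inversionParity_wordProd (ω : List B) (t : W) :
    cs.inversionParity (cs.wordProd ω) t = ((cs.rightInvSeq ω).count t : ZMod 2) := by
  rw [inversionParity, inversionAction_wordProd, zero_add]

theorem inversionAction_apply (w t : W) (ε : ZMod 2) :
    cs.inversionAction w (t, ε) = (w * t * w⁻¹, ε + cs.inversionParity w t) := by
  classical
  obtain ⟨ω, -, rfl⟩ := cs.exists_isReduced w
  rw [inversionParity_wordProd, inversionAction_wordProd]

theorem inversionParity_mul (u v t : W) :
    cs.inversionParity (u * v) t =
      cs.inversionParity v t + cs.inversionParity u (v * t * v⁻¹) := by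
  rw [inversionParity, map_mul, Equiv.Perm.mul_apply, inversionAction_apply, inversionAction_apply,
    zero_add]

theorem inversionParity_one (t : W) : cs.inversionParity 1 t = 0 := by
  simp [inversionParity]

theorem inversionParity_simple_self (i : B) : cs.inversionParity (cs.simple i) (cs.simple i) = 1 := by
  classical
  rw [← cs.wordProd_singleton, inversionParity_wordProd]
  simp

/-- For `t = u s u⁻¹` the cocycle identity leaves the parity of `s` at `s`: the contributions of `u`
and `u⁻¹` add up to the parity of `u u⁻¹ = 1`. -/
theorem IsReflection.inversionParity_self {cs : CoxeterSystem M W} {t : W}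
    (ht : cs.IsReflection t) : cs.inversionParity t t = 1 := by
  obtain ⟨u, i, rfl⟩ := ht
  have h := cs.inversionParity_mul u u⁻¹ (u * cs.simple i * u⁻¹)
  rw [mul_inv_cancel, inversionParity_one] at h
  rw [inversionParity_mul, inversionParity_mul]
  simp only [mul_assoc, inv_inv, inv_mul_cancel, mul_one, one_mul, inv_mul_cancel_left, inv_simple,
    simple_mul_simple_self, inversionParity_simple_self] at h ⊢
  linear_combination -h

theorem isRightInversion_of_inversionParity {w t : W} (h : cs.inversionParity w t ≠ 0) :
    cs.IsRightInversion w t := by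
  classical
  obtain ⟨ω, hω, rfl⟩ := cs.exists_isReduced w
  refine cs.isRightInversion_of_mem_rightInvSeq hω ?_
  rw [inversionParity_wordProd] at h
  by_contra hmem
  simp [List.count_eq_zero_of_not_mem hmem] at h

theorem isRightInversion_iff {w t : W} (ht : cs.IsReflection t) :
    cs.IsRightInversion w t ↔ cs.inversionParity w t = 1 := by
  constructor
  · intro h
    by_contra hne
    have h0 : cs.inversionParity w t = 0 := by
      revert hne; generalize cs.inversionParity w t = z; revert z; decide
    -- Even parity for `w` means odd parity for `w t`, so `t` would be an inversion of both.
    refine ht.isRightInversion_mul_left_iff.1 (cs.isRightInversion_of_inversionParity ?_) h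
    rw [inversionParity_mul, ht.inversionParity_self, mul_inv_cancel_right, h0]
    decide
  · intro h
    exact cs.isRightInversion_of_inversionParity (by rw [h]; decide)

/-- The strong exchange property: every right inversion of `w` occurs in the inversion sequence of
every word for `w`. -/
theorem mem_rightInvSeq_of_isRightInversion {ω : List B} {t : W}
    (h : cs.IsRightInversion (cs.wordProd ω) t) : t ∈ cs.rightInvSeq ω := by
  classical
  by_contra hmem
  have := (cs.isRightInversion_iff h.1).1 h
  rw [inversionParity_wordProd, List.count_eq_zero_of_not_mem hmem] at this
  exact absurd this (by decide)

/-- Each entry occurs once, hence has odd parity, hence occurs in the inversion sequence of any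
reduced word for the same element. -/
theorem isReduced_of_nodup_rightInvSeq {ω : List B} (h : (cs.rightInvSeq ω).Nodup) :
    cs.IsReduced ω := by
  classical
  obtain ⟨ω', hω', he⟩ := cs.exists_isReduced (cs.wordProd ω)
  refine le_antisymm (cs.length_wordProd_le ω) ?_
  rw [he, hω'.eq, ← cs.length_rightInvSeq ω, ← cs.length_rightInvSeq ω']
  refine (h.subperm fun t ht => cs.mem_rightInvSeq_of_isRightInversion ?_).length_le
  rw [← he]
  refine cs.isRightInversion_of_inversionParity ?_
  rw [inversionParity_wordProd, List.count_eq_one_of_mem h ht]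
  decide

/-! ### Parabolic subgroups -/

theorem simple_mem_parabolic {K : Set B} {i : B} (hi : i ∈ K) : cs.simple i ∈ cs.parabolic K :=
  Subgroup.subset_closure ⟨i, hi, rfl⟩

theorem wordProd_mem_parabolic {K : Set B} {ω : List B} (h : ∀ i ∈ ω, i ∈ K) :
    cs.wordProd ω ∈ cs.parabolic K := by
  induction ω with
  | nil => simp [one_mem]
  | cons i ω ih =>
    rw [wordProd_cons]
    exact mul_mem (cs.simple_mem_parabolic (h i (by simp))) (ih fun j hj => h j (by simp [hj]))

theorem rightInvSeq_subset_parabolic {K : Set B} {ω : List B} (h : ∀ i ∈ ω, i ∈ K) :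
    ∀ t ∈ cs.rightInvSeq ω, t ∈ cs.parabolic K := by
  induction ω with
  | nil => simp
  | cons i ω ih =>
    have hω : ∀ j ∈ ω, j ∈ K := fun j hj => h j (by simp [hj])
    have := cs.wordProd_mem_parabolic hω
    intro t ht
    rw [rightInvSeq, List.mem_cons] at ht
    rcases ht with rfl | ht
    · exact mul_mem (mul_mem (inv_mem this) (cs.simple_mem_parabolic (h i (by simp)))) this
    · exact ih hω t ht

theorem exists_word_of_mem_parabolic {K : Set B} {w : W} (hw : w ∈ cs.parabolic K) :
    ∃ ω : List B, (∀ i ∈ ω, i ∈ K) ∧ w = cs.wordProd ω := by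
  induction hw using Subgroup.closure_induction with
  | mem x hx =>
    obtain ⟨i, hi, rfl⟩ := hx
    exact ⟨[i], by simpa using hi, by simp⟩
  | one => exact ⟨[], by simp, by simp⟩
  | mul x y _ _ hx hy =>
    obtain ⟨ω, hω, rfl⟩ := hx
    obtain ⟨ω', hω', rfl⟩ := hy
    refine ⟨ω ++ ω', fun i hi => ?_, by rw [wordProd_append]⟩
    rcases List.mem_append.1 hi with h | h
    exacts [hω i h, hω' i h]
  | inv x _ hx =>
    obtain ⟨ω, hω, rfl⟩ := hx
    exact ⟨ω.reverse, by simpa using hω, by simp⟩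

theorem mem_parabolic_of_isRightInversion {K : Set B} {w t : W} (hw : w ∈ cs.parabolic K)
    (ht : cs.IsRightInversion w t) : t ∈ cs.parabolic K := by
  obtain ⟨ω, hω, rfl⟩ := cs.exists_word_of_mem_parabolic hw
  exact cs.rightInvSeq_subset_parabolic hω t (cs.mem_rightInvSeq_of_isRightInversion ht)

theorem simple_mem_parabolic_of_isRightDescent {K : Set B} {w : W} {i : B}
    (hw : w ∈ cs.parabolic K) (hi : cs.IsRightDescent w i) : cs.simple i ∈ cs.parabolic K :=
  cs.mem_parabolic_of_isRightInversion hw ((cs.isRightInversion_simple_iff_isRightDescent w i).2 hi)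

theorem exists_isReduced_of_mem_parabolic {K : Set B} {w : W} (hw : w ∈ cs.parabolic K) :
    ∃ ω : List B, cs.IsReduced ω ∧ (∀ i ∈ ω, i ∈ K) ∧ w = cs.wordProd ω := by
  obtain ⟨ω, hω, rfl⟩ := cs.exists_word_of_mem_parabolic hw
  clear hw
  induction ω using List.reverseRecOn with
  | nil => exact ⟨[], by simp [IsReduced], by simp, rfl⟩
  | append_singleton ω i ih =>
    obtain ⟨ω', hr, hK, he⟩ := ih fun j hj => hω j (by simp [hj])
    rw [wordProd_append, he, wordProd_singleton]
    -- Either the longer word is reduced, or exchange deletes a letter of `ω'`; no letter outside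
    -- `K` enters.
    by_cases hi : cs.IsRightDescent (cs.wordProd ω') i
    · have hmem := cs.mem_rightInvSeq_of_isRightInversion
        ((cs.isRightInversion_simple_iff_isRightDescent _ i).2 hi)
      obtain ⟨j, hj, hji⟩ := List.mem_iff_getElem.1 hmem
      have hprod := cs.wordProd_mul_getD_rightInvSeq ω' j
      rw [List.getD_eq_getElem _ _ hj, hji] at hprod
      refine ⟨ω'.eraseIdx j, ?_, fun k hk => hK k (List.mem_of_mem_eraseIdx hk), hprod⟩
      have h1 := cs.isRightDescent_iff.1 hi
      rw [length_rightInvSeq] at hj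
      have h2 := List.length_eraseIdx_add_one hj
      have h3 := hr.eq
      rw [IsReduced, ← hprod]
      omega
    · refine ⟨ω' ++ [i], ?_, ?_, by rw [wordProd_append, wordProd_singleton]⟩
      · rw [IsReduced, wordProd_append, wordProd_singleton, cs.not_isRightDescent_iff.1 hi, hr.eq]
        simp
      · intro k hk
        rcases List.mem_append.1 hk with h | h
        · exact hK k h
        · exact hω k (by simp_all)

/-- A simple reflection in `W_K` coincides with the simple reflection of some element of `K`. -/
theorem exists_simple_eq_of_mem_parabolic {K : Set B} {i : B}
    (hi : cs.simple i ∈ cs.parabolic K) : ∃ j ∈ K, cs.simple i = cs.simple j := by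
  obtain ⟨ω, hr, hω, he⟩ := cs.exists_isReduced_of_mem_parabolic hi
  have h1 : ω.length = 1 := by rw [← hr.eq, ← he, length_simple]
  obtain ⟨j, rfl⟩ := List.length_eq_one_iff.1 h1
  exact ⟨j, hω j (by simp), by simpa using he⟩

theorem mem_parabolic_univ (w : W) : w ∈ cs.parabolic Set.univ := by
  simp [parabolic, Set.image_univ, cs.subgroup_closure_range_simple]

/-! ### Longest elements -/

section Finite

variable [Finite W]

/-- Every reflection of `W_K` is an inversion of the longest element of `W_K`. -/
theorem isRightInversion_longestIn {K : Set B} {t : W} (ht : cs.IsReflection t)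
    (htK : t ∈ cs.parabolic K) : cs.IsRightInversion (cs.longestIn K) t :=
  ⟨ht, lt_of_le_of_ne ((cs.longestIn_spec K).2 _ (mul_mem (cs.longestIn_spec K).1 htK))
    (ht.length_mul_left_ne _)⟩

/-- Each further letter `s` of a reduced word for `w` shortens the product with `v = (w₀)_K`. Write
`s w' v = w' v t`: the reflection `t` is an inversion of `v`, while `v t v⁻¹` is not one of `w'`
because `s w'` is longer. By the cocycle identity `t` is an inversion of `w' v`. -/
theorem length_mul_longestIn {K : Set B} {w : W} (hw : w ∈ cs.parabolic K) :
    cs.length (w * cs.longestIn K) + cs.length w = cs.length (cs.longestIn K) := by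
  obtain ⟨ω, hr, hK, rfl⟩ := cs.exists_isReduced_of_mem_parabolic hw
  clear hw
  induction ω with
  | nil => simp
  | cons i ω ih =>
    have hr' : cs.IsReduced ω := hr.drop 1
    have hK' : ∀ j ∈ ω, j ∈ K := fun j hj => hK j (by simp [hj])
    have hlen := ih hr' hK'
    set w' := cs.wordProd ω with hw'
    set v := cs.longestIn K with hv
    have hmem : w' * v ∈ cs.parabolic K :=
      mul_mem (cs.wordProd_mem_parabolic hK') (cs.longestIn_spec K).1
    have hi : cs.simple i ∈ cs.parabolic K := cs.simple_mem_parabolic (hK i (by simp))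
    set t := (w' * v)⁻¹ * cs.simple i * (w' * v) with ht
    have htr : cs.IsReflection t := by
      simpa [ht] using (cs.isReflection_simple i).conj (w' * v)⁻¹
    have htK : t ∈ cs.parabolic K := mul_mem (mul_mem (inv_mem hmem) hi) hmem
    have hconj : v * t * v⁻¹ = w'⁻¹ * cs.simple i * w' := by simp [ht, mul_assoc]
    have htr' : cs.IsReflection (v * t * v⁻¹) := htr.conj v
    have hwt : w' * (v * t * v⁻¹) = cs.simple i * w' := by rw [hconj]; simp [mul_assoc]
    have hlen' : cs.length (cs.simple i * w') = cs.length w' + 1 := by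
      rw [hw', hr'.eq, ← wordProd_cons, hr.eq, List.length_cons]
    have h0 : cs.inversionParity w' (v * t * v⁻¹) ≠ 1 := by
      rw [Ne, ← cs.isRightInversion_iff htr']
      rintro ⟨-, h⟩
      rw [hwt] at h
      omega
    have h0' : cs.inversionParity w' (v * t * v⁻¹) = 0 := by
      revert h0; generalize cs.inversionParity w' (v * t * v⁻¹) = z; revert z; decide
    have h1 : cs.IsRightInversion (w' * v) t := by
      rw [cs.isRightInversion_iff htr, inversionParity_mul, h0', add_zero,
        ← cs.isRightInversion_iff htr]
      exact cs.isRightInversion_longestIn htr htK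
    have h2 : w' * v * t = cs.simple i * (w' * v) := by simp [ht, mul_assoc]
    have h3 : cs.IsLeftDescent (w' * v) i := by
      have := h1.2
      rwa [h2] at this
    rw [cs.isLeftDescent_iff] at h3
    rw [wordProd_cons, ← hw', mul_assoc, hlen']
    omega

theorem longestIn_mul_self (K : Set B) : cs.longestIn K * cs.longestIn K = 1 := by
  have := cs.length_mul_longestIn (cs.longestIn_spec K).1
  rw [← cs.length_eq_zero_iff]
  omega

theorem inv_longestIn (K : Set B) : (cs.longestIn K)⁻¹ = cs.longestIn K :=
  inv_eq_of_mul_eq_one_left (cs.longestIn_mul_self K)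

theorem inv_longest : cs.longest⁻¹ = cs.longest := cs.inv_longestIn _

theorem longest_mul_self : cs.longest * cs.longest = 1 := cs.longestIn_mul_self _

theorem length_mul_longest (w : W) :
    cs.length (w * cs.longest) + cs.length w = cs.length cs.longest :=
  cs.length_mul_longestIn (cs.mem_parabolic_univ w)

/-- If `x = (w₀)_K w₀`, then lengths add in products `g x` with `g ∈ W_K`. -/
theorem length_mul_longestIn_mul_longest {K : Set B} {g : W} (hg : g ∈ cs.parabolic K) :
    cs.length (g * (cs.longestIn K * cs.longest)) =
      cs.length g + cs.length (cs.longestIn K * cs.longest) := by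
  have h1 := cs.length_mul_longest (g * cs.longestIn K)
  have h2 := cs.length_mul_longest (cs.longestIn K)
  have h3 := cs.length_mul_longestIn hg
  rw [mul_assoc] at h1
  omega

end Finite

/-! ### The weak order through lengths -/

/-- The weak order relation. -/
def WeakLE (u w : W) : Prop := Relation.ReflTransGen cs.WeakStep u w

/-- The order is the prefix order; conversely, right descents of `u⁻¹ w` are stripped off one at a
time. -/
theorem weakLE_iff {u w : W} :
    cs.WeakLE u w ↔ cs.length u + cs.length (u⁻¹ * w) = cs.length w := by
  constructor
  · intro h
    induction h with
    | refl => simp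
    | @tail v w _ hstep ih =>
      obtain ⟨i, hi, rfl⟩ := hstep
      have h1 := cs.isRightDescent_iff.1 hi
      have h2 := cs.length_mul_le u (u⁻¹ * w)
      have h3 := cs.length_mul_simple (u⁻¹ * w) i
      rw [mul_inv_cancel_left] at h2
      rw [mul_assoc] at h3
      omega
  · intro h
    induction hn : cs.length (u⁻¹ * w) generalizing w with
    | zero =>
      rw [length_eq_zero_iff, inv_mul_eq_one] at hn
      exact hn ▸ .refl
    | succ n ih =>
      have hne : u⁻¹ * w ≠ 1 := by
        rw [Ne, ← cs.length_eq_zero_iff]; omega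
      obtain ⟨i, hi⟩ := cs.exists_rightDescent_of_ne_one hne
      rw [isRightDescent_iff, mul_assoc] at hi
      have h1 := cs.length_mul_le u (u⁻¹ * (w * cs.simple i))
      rw [mul_inv_cancel_left] at h1
      have h2 := cs.length_mul_simple w i
      refine (ih (w := w * cs.simple i) (by omega) (by omega)).tail ⟨i, ?_, rfl⟩
      rw [isRightDescent_iff]
      omega

theorem WeakLE.refl (w : W) : cs.WeakLE w w := Relation.ReflTransGen.refl

theorem WeakLE.eq_of_length_le {cs : CoxeterSystem M W} {u w : W} (h : cs.WeakLE u w)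
    (hl : cs.length w ≤ cs.length u) : u = w := by
  rw [weakLE_iff] at h
  have : cs.length (u⁻¹ * w) = 0 := by omega
  rwa [length_eq_zero_iff, inv_mul_eq_one] at this

theorem WeakLE.eq_or_weakLE_mul_simple {cs : CoxeterSystem M W} {u w : W} (h : cs.WeakLE u w) :
    u = w ∨ ∃ i, cs.IsRightDescent w i ∧ cs.WeakLE u (w * cs.simple i) := by
  rcases Relation.ReflTransGen.cases_tail h with h | ⟨v, hv, i, hi, rfl⟩
  · exact .inl h.symm
  · exact .inr ⟨i, hi, hv⟩

theorem weakCovBy_iff {u w : W} : cs.WeakCovBy u w ↔ cs.WeakStep u w := by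
  let _ := cs.weakOrder
  change u ⋖ w ↔ _
  have hlt {a b : W} (i : B) (hi : cs.IsRightDescent b i) : b * cs.simple i < b := by
    refine lt_of_le_of_ne (Relation.ReflTransGen.single ⟨i, hi, rfl⟩) fun h => ?_
    rw [IsRightDescent, h] at hi
    exact lt_irrefl _ hi
  have hlen {a b : W} (h : a < b) : cs.length a < cs.length b := by
    by_contra hle
    exact h.ne (WeakLE.eq_of_length_le (cs := cs) h.le (not_lt.1 hle))
  constructor
  · intro h
    rcases WeakLE.eq_or_weakLE_mul_simple (cs := cs) h.le with he | ⟨i, hi, hle⟩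
    · exact absurd he h.ne
    · refine ⟨i, hi, ?_⟩
      by_contra hne
      exact h.2 (lt_of_le_of_ne hle hne) (hlt (a := w) i hi)
  · rintro ⟨i, hi, rfl⟩
    refine ⟨hlt (a := w) i hi, fun c h1 h2 => ?_⟩
    have := hlen h1
    have := hlen h2
    have := cs.isRightDescent_iff.1 hi
    omega

theorem isWeakJoin_iff {a b j : W} :
    cs.IsWeakJoin a b j ↔
      cs.WeakLE a j ∧ cs.WeakLE b j ∧ ∀ c, cs.WeakLE a c → cs.WeakLE b c → cs.WeakLE j c := by
  let _ := cs.weakOrder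
  change IsLUB {a, b} j ↔ _
  simp only [IsLUB, IsLeast, upperBounds_insert, upperBounds_singleton, mem_lowerBounds,
    Set.mem_inter_iff, Set.mem_Ici, and_imp, and_assoc]
  rfl

theorem isWeakMeet_iff {a b m : W} :
    cs.IsWeakMeet a b m ↔
      cs.WeakLE m a ∧ cs.WeakLE m b ∧ ∀ c, cs.WeakLE c a → cs.WeakLE c b → cs.WeakLE c m := by
  let _ := cs.weakOrder
  change IsGLB {a, b} m ↔ _
  simp only [IsGLB, IsGreatest, lowerBounds_insert, lowerBounds_singleton, mem_upperBounds,
    Set.mem_inter_iff, Set.mem_Iic, and_imp, and_assoc]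
  rfl

theorem WeakLE.mem_parabolic {cs : CoxeterSystem M W} {K : Set B} {u w : W} (h : cs.WeakLE u w)
    (hw : w ∈ cs.parabolic K) : u ∈ cs.parabolic K := by
  induction h with
  | refl => exact hw
  | tail _ hstep ih =>
    obtain ⟨i, hi, rfl⟩ := hstep
    exact ih (mul_mem hw (cs.simple_mem_parabolic_of_isRightDescent hw hi))

/-! ### Order reversal by longest elements, and the interval above `(w₀)_K w₀`. -/

section Finite

variable [Finite W]

theorem length_conj_longestIn {K : Set B} {v : W} (hv : v ∈ cs.parabolic K) :
    cs.length ((cs.longestIn K)⁻¹ * v * cs.longestIn K) = cs.length v := by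
  have hK := (cs.longestIn_spec K).1
  have h1 := cs.length_mul_longestIn (mul_mem (inv_mem hK) hv)
  have h2 := cs.length_mul_longestIn (inv_mem hv)
  rw [← cs.length_inv ((cs.longestIn K)⁻¹ * v), mul_inv_rev, inv_inv] at h1
  rw [length_inv] at h2
  omega

theorem weakLE_mul_longestIn_iff {K : Set B} {u w : W} (hu : u ∈ cs.parabolic K)
    (hw : w ∈ cs.parabolic K) :
    cs.WeakLE (u * cs.longestIn K) (w * cs.longestIn K) ↔ cs.WeakLE w u := by
  have h1 := cs.length_mul_longestIn hu
  have h2 := cs.length_mul_longestIn hw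
  have h3 := cs.length_conj_longestIn (mul_mem (inv_mem hu) hw)
  have h4 : (u * cs.longestIn K)⁻¹ * (w * cs.longestIn K) =
      (cs.longestIn K)⁻¹ * (u⁻¹ * w) * cs.longestIn K := by group
  have h5 : cs.length (w⁻¹ * u) = cs.length (u⁻¹ * w) := by rw [← length_inv]; simp
  rw [weakLE_iff, weakLE_iff, h4]
  omega

theorem weakLE_mul_longest_iff {u w : W} :
    cs.WeakLE (u * cs.longest) (w * cs.longest) ↔ cs.WeakLE w u :=
  cs.weakLE_mul_longestIn_iff (cs.mem_parabolic_univ u) (cs.mem_parabolic_univ w)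

theorem weakLE_mul_longestIn_mul_longest_iff {K : Set B} {g h : W} (hg : g ∈ cs.parabolic K)
    (hh : h ∈ cs.parabolic K) :
    cs.WeakLE g (h * (cs.longestIn K * cs.longest)) ↔ cs.WeakLE g h := by
  have h1 := cs.length_mul_longestIn_mul_longest hh
  have h2 := cs.length_mul_longestIn_mul_longest (mul_mem (inv_mem hg) hh)
  rw [mul_assoc] at h2
  rw [weakLE_iff, weakLE_iff]
  omega

theorem weakLE_longestIn_iff {K : Set B} {g : W} :
    cs.WeakLE g (cs.longestIn K) ↔ g ∈ cs.parabolic K := by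
  refine ⟨fun h => h.mem_parabolic (cs.longestIn_spec K).1, fun hg => ?_⟩
  have h1 := cs.length_mul_longestIn (inv_mem hg)
  rw [length_inv] at h1
  rw [weakLE_iff]
  omega

/-- The elements above `(w₀)_K w₀` are those of the coset `W_K (w₀)_K w₀`. -/
theorem longestIn_mul_longest_weakLE_iff {K : Set B} {c : W} :
    cs.WeakLE (cs.longestIn K * cs.longest) c ↔
      ∃ g ∈ cs.parabolic K, c = g * (cs.longestIn K * cs.longest) := by
  have hc : c = c * cs.longest * cs.longest := by rw [mul_assoc, longest_mul_self, mul_one]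
  rw [hc, weakLE_mul_longest_iff, weakLE_longestIn_iff, ← hc]
  constructor
  · intro h
    refine ⟨c * cs.longest * cs.longestIn K, mul_mem h (cs.longestIn_spec K).1, ?_⟩
    rw [mul_assoc _ (cs.longestIn K), ← mul_assoc (cs.longestIn K), longestIn_mul_self, one_mul,
      ← hc]
  · rintro ⟨g, hg, rfl⟩
    rw [mul_assoc, mul_assoc, longest_mul_self, mul_one]
    exact mul_mem hg (cs.longestIn_spec K).1

theorem isWeakJoin_mul_longestIn_mul_longest {K : Set B} {g : W} (hg : g ∈ cs.parabolic K) :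
    cs.IsWeakJoin g (cs.longestIn K * cs.longest) (g * (cs.longestIn K * cs.longest)) := by
  rw [isWeakJoin_iff]
  refine ⟨(cs.weakLE_mul_longestIn_mul_longest_iff hg hg).2 (.refl cs g),
    cs.longestIn_mul_longest_weakLE_iff.2 ⟨g, hg, rfl⟩, fun c h1 h2 => ?_⟩
  obtain ⟨h, hh, rfl⟩ := cs.longestIn_mul_longest_weakLE_iff.1 h2
  rw [weakLE_mul_longestIn_mul_longest_iff _ hg hh] at h1
  -- Right multiplication by `(w₀)_K` and then by `w₀` reverses the order twice.
  rwa [← mul_assoc, ← mul_assoc, weakLE_mul_longest_iff, weakLE_mul_longestIn_iff _ hh hg]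

theorem isWeakMeet_mul_longestIn_mul_longest {K : Set B} {g : W} (hg : g ∈ cs.parabolic K) :
    cs.IsWeakMeet (g * (cs.longestIn K * cs.longest)) (cs.longestIn K) g := by
  rw [isWeakMeet_iff]
  refine ⟨(cs.weakLE_mul_longestIn_mul_longest_iff hg hg).2 (.refl cs g),
    cs.weakLE_longestIn_iff.2 hg, fun c h1 h2 => ?_⟩
  rwa [weakLE_mul_longestIn_mul_longest_iff _ (cs.weakLE_longestIn_iff.1 h2) hg] at h1

end Finite

/-! ### The geometric representation and the order of `s t` -/

section Geometric

open Polynomial.Chebyshev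

/-- Powers of a product of two reflections have coefficients given by these polynomials; here `θ =
2π / m`, which excludes `m = 0, 2`. -/
theorem eval_S_eq_div {θ : ℝ} (h : Real.sin θ ≠ 0) (n : ℤ) :
    (S ℝ n).eval (2 * Real.cos θ) = Real.sin ((n + 1) * θ) / Real.sin θ := by
  rw [eq_div_iff h, S_two_mul_real_cos]

/-- The linear form pairing with the simple root `i`, up to scaling: `e_j ↦ -2 cos (π / m(i, j))`. -/
noncomputable def rootForm (M : CoxeterMatrix B) (i : B) : Module.Dual ℝ (B →₀ ℝ) :=
  Finsupp.linearCombination ℝ (fun j => -2 * Real.cos (Real.pi / M i j))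

theorem rootForm_single (M : CoxeterMatrix B) (i j : B) :
    rootForm M i (Finsupp.single j 1) = -2 * Real.cos (Real.pi / M i j) := by
  simp [rootForm]

theorem rootForm_self (M : CoxeterMatrix B) (i : B) :
    rootForm M i (Finsupp.single i 1) = 2 := by
  simp [rootForm_single]

/-- The reflection in the simple root `i`. -/
noncomputable def rootReflection (M : CoxeterMatrix B) (i : B) : (B →₀ ℝ) ≃ₗ[ℝ] (B →₀ ℝ) :=
  Module.reflection (rootForm_self M i)

theorem rootForm_mul_sub_two (M : CoxeterMatrix B) (i j : B) :
    rootForm M i (Finsupp.single j 1) * rootForm M j (Finsupp.single i 1) - 2 =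
      2 * Real.cos (2 * Real.pi / M i j) := by
  rw [rootForm_single, rootForm_single, M.symmetric j i, mul_div_assoc, Real.cos_two_mul]
  ring

theorem sin_two_pi_div_ne_zero {m : ℕ} (hm : 3 ≤ m) : Real.sin (2 * Real.pi / m) ≠ 0 := by
  have h3 : (3 : ℝ) ≤ m := by exact_mod_cast hm
  refine (Real.sin_pos_of_pos_of_lt_pi (by positivity) ?_).ne'
  rw [div_lt_iff₀ (by positivity)]
  nlinarith [Real.pi_pos]

theorem rootReflection_mul_pow (M : CoxeterMatrix B) (i j : B) :
    (rootReflection M i * rootReflection M j) ^ M i j = 1 := by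
  rcases eq_or_ne i j with rfl | hij
  · ext1 z
    rw [M.diagonal, pow_one]
    exact Module.involutive_reflection (rootForm_self M i) z
  have h1 := M.off_diagonal i j hij
  ext1 z
  have key := Module.reflection_mul_reflection_pow_apply (rootForm_self M i) (rootForm_self M j)
    (M i j) z _ (rootForm_mul_sub_two M i j).symm
  rw [rootReflection, rootReflection, key, LinearEquiv.coe_one, id]
  obtain h | h | h : M i j = 0 ∨ M i j = 2 ∨ 3 ≤ M i j := by omega
  · simp [h]
  · have e1 : rootForm M i (Finsupp.single j 1) = 0 := by simp [rootForm_single, h]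
    have e2 : rootForm M j (Finsupp.single i 1) = 0 := by simp [rootForm_single, M.symmetric j i, h]
    rw [e1, e2, h]
    norm_num
    abel
  · have hs := sin_two_pi_div_ne_zero h
    have hm : (M i j : ℝ) ≠ 0 := by positivity
    set θ := 2 * Real.pi / M i j with hθ
    have hmθ : M i j * θ = 2 * Real.pi := by rw [hθ]; field_simp
    -- The indices use integer division. For `m = 2n` the first factors vanish since `nθ = π`; for
    -- `m = 2n + 1` the sums vanish since `(n + 1)θ = 2π - nθ`.
    have hz1 : (S ℝ (((M i j : ℤ) - 2) / 2)).eval (2 * Real.cos θ) *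
        ((S ℝ (((M i j : ℤ) - 1) / 2)).eval (2 * Real.cos θ) +
          (S ℝ (((M i j : ℤ) - 3) / 2)).eval (2 * Real.cos θ)) = 0 ∧
        (S ℝ (((M i j : ℤ) - 1) / 2)).eval (2 * Real.cos θ) *
        ((S ℝ ((M i j : ℤ) / 2)).eval (2 * Real.cos θ) +
          (S ℝ (((M i j : ℤ) - 2) / 2)).eval (2 * Real.cos θ)) = 0 := by
      simp only [eval_S_eq_div hs]
      rcases Nat.even_or_odd' (M i j) with ⟨n, hn | hn⟩
      · have a1 : ((M i j : ℤ) - 2) / 2 = n - 1 := by omega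
        have a2 : ((M i j : ℤ) - 1) / 2 = n - 1 := by omega
        have hnθ : Real.sin (n * θ) = 0 := by
          have : n * θ = Real.pi := by rw [hn] at hmθ; push_cast at hmθ; linarith
          rw [this, Real.sin_pi]
        rw [a1, a2]
        push_cast
        simp [hnθ]
      · have a1 : ((M i j : ℤ) - 2) / 2 = n - 1 := by omega
        have a2 : ((M i j : ℤ) - 1) / 2 = n := by omega
        have a3 : ((M i j : ℤ) - 3) / 2 = n - 1 := by omega
        have a4 : (M i j : ℤ) / 2 = n := by omega
        have hnθ : Real.sin ((n + 1) * θ) = - Real.sin (n * θ) := by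
          have : (n + 1) * θ = 2 * Real.pi - n * θ := by
            rw [hn] at hmθ; push_cast at hmθ; linarith
          rw [this, Real.sin_two_pi_sub]
        rw [a1, a2, a3, a4]
        push_cast
        simp [hnθ, neg_div]
    rw [hz1.1, hz1.2]
    simp

/-- The geometric representation of `W`. -/
noncomputable def geometricRep : W →* ((B →₀ ℝ) ≃ₗ[ℝ] (B →₀ ℝ)) :=
  cs.lift ⟨rootReflection M, rootReflection_mul_pow M⟩

theorem geometricRep_simple (i : B) : cs.geometricRep (cs.simple i) = rootReflection M i :=
  cs.lift_apply_simple _ i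

/-- The order of `s_i s_j` is a multiple of `m(i, j)`. -/
theorem dvd_of_simple_mul_simple_pow_eq_one {i j : B} (hij : i ≠ j) {k : ℕ}
    (hk : (cs.simple i * cs.simple j) ^ k = 1) : M i j ∣ k := by
  have h1 := M.off_diagonal i j hij
  have key := Module.reflection_mul_reflection_pow_apply_self (rootForm_self M i)
    (rootForm_self M j) k _ (rootForm_mul_sub_two M i j).symm
  have hrep : (rootReflection M i * rootReflection M j) ^ k = 1 := by
    have := congrArg cs.geometricRep hk
    simpa [geometricRep_simple] using this
  rw [rootReflection, rootReflection] at hrep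
  rw [hrep, LinearEquiv.coe_one, id] at key
  have hi := DFunLike.congr_fun key i
  have hj := DFunLike.congr_fun key j
  simp [hij, hij.symm, rootForm_single, M.symmetric j i] at hi hj
  obtain h | h | h : M i j = 0 ∨ M i j = 2 ∨ 3 ≤ M i j := by omega
  -- Division by zero gives angle `0`, so the polynomial is evaluated at `2`, where its value is
  -- `k`.
  · simp [h] at hj
    simp [hj]
  · rw [h] at hi ⊢
    have e : 2 * Real.pi / (2 : ℕ) = Real.pi := by push_cast; ring
    rw [e, Real.cos_pi, show (2 * -1 : ℝ) = -2 by norm_num, S_eval_neg_two, S_eval_neg_two,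
      Int.negOnePow_sub, Int.negOnePow_one] at hi
    rcases Nat.even_or_odd k with hk | hk
    · exact hk.two_dvd
    · rw [Int.negOnePow_odd _ (by exact_mod_cast hk)] at hi
      push_cast at hi
      norm_num at hi
  -- The `e_j` coordinate gives `sin kθ = 0`; the `e_i` coordinate then gives `cos kθ = 1`.
  · have hs := sin_two_pi_div_ne_zero h
    have hm : (M i j : ℝ) ≠ 0 := by positivity
    have hc : Real.cos (Real.pi / M i j) ≠ 0 := by
      intro h0
      apply hs
      rw [mul_div_assoc, Real.sin_two_mul, h0, mul_zero]
    replace hj := hj.resolve_right hc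
    rw [hj, add_zero, eval_S_eq_div hs, eq_div_iff hs] at hi
    rw [eval_S_eq_div hs, div_eq_zero_iff, or_iff_left hs] at hj
    set θ := 2 * Real.pi / M i j with hθ
    push_cast at hi hj
    rw [sub_add_cancel] at hj
    rw [one_mul, add_mul, one_mul, Real.sin_add, hj, zero_mul, zero_add] at hi
    have hcos : Real.cos (k * θ) = 1 := mul_right_cancel₀ hs (by rw [one_mul]; exact hi.symm)
    obtain ⟨n, hn⟩ := (Real.cos_eq_one_iff _).1 hcos
    have hnk : (n * M i j : ℝ) = k := by
      have hπ := Real.pi_ne_zero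
      rw [hθ] at hn
      field_simp at hn
      linarith
    exact Int.natCast_dvd_natCast.1 ⟨n, by rw [mul_comm]; exact_mod_cast hnk.symm⟩

end Geometric

theorem simple_injective : Function.Injective cs.simple := by
  intro i j h
  by_contra hij
  have := cs.dvd_of_simple_mul_simple_pow_eq_one hij (k := 1) (by rw [h]; simp)
  exact M.off_diagonal i j hij (Nat.dvd_one.1 this)

theorem simple_mem_parabolic_iff {K : Set B} {i : B} : cs.simple i ∈ cs.parabolic K ↔ i ∈ K := by
  refine ⟨fun h => ?_, cs.simple_mem_parabolic⟩
  obtain ⟨j, hj, he⟩ := cs.exists_simple_eq_of_mem_parabolic h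
  exact cs.simple_injective he ▸ hj

theorem orderOf_simple_mul_simple (i j : B) : orderOf (cs.simple i * cs.simple j) = M i j := by
  rcases eq_or_ne i j with rfl | hij
  · simp
  · exact Nat.dvd_antisymm (orderOf_dvd_of_pow_eq_one (cs.simple_mul_simple_pow i j))
      (cs.dvd_of_simple_mul_simple_pow_eq_one hij (pow_orderOf_eq_one _))

theorem mem_of_isRightDescent {K : Set B} {w : W} {i : B} (hw : w ∈ cs.parabolic K)
    (hi : cs.IsRightDescent w i) : i ∈ K :=
  cs.simple_mem_parabolic_iff.1 (cs.simple_mem_parabolic_of_isRightDescent hw hi)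

/-- The last letter is a right descent, so it lies in `K` and can be removed. This makes the support
independent of the reduced word. -/
theorem mem_of_isReduced {K : Set B} {ω : List B} (hω : cs.IsReduced ω)
    (h : cs.wordProd ω ∈ cs.parabolic K) : ∀ i ∈ ω, i ∈ K := by
  induction ω using List.reverseRecOn with
  | nil => simp
  | append_singleton ω i ih =>
    have hr : cs.IsReduced ω := by simpa using hω.take ω.length
    have hi : cs.IsRightDescent (cs.wordProd (ω ++ [i])) i := by
      rw [IsRightDescent, hω.eq, wordProd_append, wordProd_singleton, simple_mul_simple_cancel_right,
        hr.eq]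
      simp
    have hiK := cs.mem_of_isRightDescent h hi
    have hωK : cs.wordProd ω ∈ cs.parabolic K := by
      have := mul_mem h (cs.simple_mem_parabolic hiK)
      rwa [wordProd_append, wordProd_singleton, simple_mul_simple_cancel_right] at this
    intro j hj
    rcases List.mem_append.1 hj with hj | hj
    · exact ih hr hωK j hj
    · rw [List.mem_singleton.1 hj]; exact hiK

theorem support_wordProd {ω : List B} (hω : cs.IsReduced ω) :
    cs.support (cs.wordProd ω) = {i | i ∈ ω} := by
  ext i
  constructor
  · rintro ⟨ω', hr, he, hi⟩
    exact cs.mem_of_isReduced (K := {i | i ∈ ω}) hr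
      (he ▸ cs.wordProd_mem_parabolic fun _ h => h) i hi
  · exact fun hi => ⟨ω, hω, rfl, hi⟩

/-! ### Alternating words -/

theorem length_alternatingFrom (a b : B) (k : ℕ) : (alternatingFrom a b k).length = k := by
  induction k generalizing a b with
  | zero => rfl
  | succ k ih => simp [alternatingFrom, ih]

theorem alternatingFrom_add (a b : B) (j k : ℕ) :
    alternatingFrom a b (j + k) = alternatingFrom a b j ++
      if Even j then alternatingFrom a b k else alternatingFrom b a k := by
  induction j generalizing a b with
  | zero => simp [alternatingFrom]
  | succ j ih =>
    rw [Nat.succ_add, alternatingFrom, alternatingFrom, ih]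
    by_cases h : Even j <;> simp [Nat.even_add_one, h]

theorem mem_alternatingFrom {a b i : B} {k : ℕ} (h : i ∈ alternatingFrom a b k) :
    i = a ∨ i = b := by
  induction k generalizing a b with
  | zero => simp [alternatingFrom] at h
  | succ k ih =>
    rcases List.mem_cons.1 h with h | h
    · exact .inl h
    · exact (ih h).symm

theorem alternatingFrom_reverse (a b : B) (k : ℕ) :
    (alternatingFrom a b k).reverse =
      if Even k then alternatingFrom b a k else alternatingFrom a b k := by
  induction k generalizing a b with
  | zero => simp [alternatingFrom]
  | succ k ih =>
    nth_rw 1 [alternatingFrom]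
    rw [List.reverse_cons, ih, alternatingFrom_add a b, alternatingFrom_add b a]
    by_cases h : Even k <;> simp [Nat.even_add_one, h, alternatingFrom]

/-- These entries are distinct exactly while `k` does not exceed the order of `ab`, which decides
reducedness both ways. -/
theorem leftInvSeq_alternatingFrom (a b : B) (k : ℕ) :
    cs.leftInvSeq (alternatingFrom a b k) =
      (List.range k).map fun j => (cs.simple a * cs.simple b) ^ j * cs.simple a := by
  induction k generalizing a b with
  | zero => rfl
  | succ k ih =>
    rw [alternatingFrom, leftInvSeq, ih, List.range_succ_eq_map, List.map_cons, List.map_map,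
      List.map_map, pow_zero, one_mul]
    congr 1
    refine List.map_congr_left fun j _ => ?_
    have h : SemiconjBy (cs.simple a) (cs.simple b * cs.simple a) (cs.simple a * cs.simple b) := by
      simp [SemiconjBy, mul_assoc]
    have hj := (h.pow_right j).eq
    simp only [Function.comp_apply, MulAut.conj_apply, inv_simple, Nat.succ_eq_add_one, pow_succ]
    rw [← mul_assoc, hj]
    simp only [mul_assoc]

theorem isReduced_alternatingFrom {a b : B} {k : ℕ} (hk : k ≤ M a b) :
    cs.IsReduced (alternatingFrom a b k) := by
  rw [← isReduced_reverse_iff]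
  refine cs.isReduced_of_nodup_rightInvSeq ?_
  rw [rightInvSeq_reverse, List.nodup_reverse, leftInvSeq_alternatingFrom]
  refine List.Nodup.map_on (fun x hx y hy hxy => ?_) List.nodup_range
  rw [← cs.orderOf_simple_mul_simple a b] at hk
  exact pow_injOn_Iio_orderOf (Set.mem_Iio.2 ((List.mem_range.1 hx).trans_le hk))
    (Set.mem_Iio.2 ((List.mem_range.1 hy).trans_le hk)) (mul_right_cancel hxy)

theorem le_of_isReduced_alternatingFrom {a b : B} {k : ℕ} (hM : M a b ≠ 0)
    (h : cs.IsReduced (alternatingFrom a b k)) : k ≤ M a b := by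
  by_contra! hk
  have hnd := h.nodup_leftInvSeq
  rw [leftInvSeq_alternatingFrom] at hnd
  refine hM (List.inj_on_of_nodup_map hnd (List.mem_range.2 hk)
    (List.mem_range.2 (Nat.zero_lt_of_lt hk)) ?_)
  simp

theorem eq_alternatingFrom_of_isReduced {a b : B} {ω : List B} (hω : cs.IsReduced ω)
    (hab : ∀ i ∈ ω, i = a ∨ i = b) :
    ω = alternatingFrom a b ω.length ∨ ω = alternatingFrom b a ω.length := by
  induction ω with
  | nil => exact .inl rfl
  | cons i ω ih =>
    have hr : cs.IsReduced ω := hω.drop 1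
    have hcons : ∀ ω', ω ≠ i :: ω' := by
      rintro ω' rfl
      have h1 := hω.eq
      have h2 := cs.length_wordProd_le ω'
      rw [wordProd_cons, wordProd_cons, simple_mul_simple_cancel_left] at h1
      simp only [List.length_cons] at h1
      omega
    have key : ∀ c d : B, ω = alternatingFrom c d ω.length → (i = c ∨ i = d) →
        i :: ω = alternatingFrom d c (ω.length + 1) ∨ ω = [] := by
      intro c d he hi
      rcases hn : ω.length with _ | n
      · exact .inr (List.eq_nil_of_length_eq_zero hn)
      · rw [hn] at he
        rcases hi with rfl | rfl
        · exact absurd he (hcons _)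
        · rw [he]; exact .inl rfl
    have hi := hab i (by simp)
    have hnil : ω = [] → i :: ω = alternatingFrom a b (ω.length + 1) ∨
        i :: ω = alternatingFrom b a (ω.length + 1) := by
      rintro rfl
      simpa [alternatingFrom] using hi
    rw [List.length_cons]
    rcases ih hr fun j hj => hab j (by simp [hj]) with h | h
    · rcases key a b h hi with h' | h'
      exacts [.inr h', hnil h']
    · rcases key b a h hi.symm with h' | h'
      exacts [.inl h', hnil h']

theorem wordProd_alternatingFrom_mem (a b : B) (k : ℕ) :
    cs.wordProd (alternatingFrom a b k) ∈ cs.parabolic {a, b} :=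
  cs.wordProd_mem_parabolic fun _ hi => mem_alternatingFrom hi

theorem support_alternatingFrom {a b : B} {k : ℕ} (h : cs.IsReduced (alternatingFrom a b (k + 2))) :
    cs.support (cs.wordProd (alternatingFrom a b (k + 2))) = {a, b} := by
  rw [cs.support_wordProd h]
  ext i
  refine ⟨mem_alternatingFrom, ?_⟩
  rintro (rfl | rfl) <;> simp [alternatingFrom]

theorem degree_alternatingFrom_eq_two_iff {a b : B} {k : ℕ}
    (h : cs.IsReduced (alternatingFrom a b k)) :
    cs.degree (cs.wordProd (alternatingFrom a b k)) = 2 ↔ a ≠ b ∧ 2 ≤ k := by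
  rcases k with _ | _ | k
  · rw [degree, cs.support_wordProd h]
    simp [alternatingFrom]
  · rw [degree, cs.support_wordProd h]
    simp [alternatingFrom]
  · rw [degree, cs.support_alternatingFrom h]
    by_cases hab : a = b
    · simp [hab]
    · simp [hab, Set.ncard_pair hab]

theorem exists_eq_simple_of_degree_eq_one {w : W} (h : cs.degree w = 1) :
    ∃ i, w = cs.simple i := by
  obtain ⟨ω, hω, rfl⟩ := cs.exists_isReduced w
  rw [degree, cs.support_wordProd hω, Set.ncard_eq_one] at h
  obtain ⟨i, hi⟩ := h
  have hmem : ∀ j ∈ ω, j = i := fun j hj => hi.subset hj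
  refine ⟨i, ?_⟩
  -- A word in one letter counts as alternating with `a = b`; then `M i i = 1` bounds its length.
  have he : ω = alternatingFrom i i ω.length := by
    simpa using cs.eq_alternatingFrom_of_isReduced hω (a := i) (b := i) (by simpa using hmem)
  have hle : ω.length ≤ 1 := by
    have := cs.le_of_isReduced_alternatingFrom (a := i) (b := i) (by simp) (he ▸ hω)
    simpa using this
  have hne : ω ≠ [] := by
    rintro rfl
    simpa using hi.symm.subset (Set.mem_singleton i)
  have hpos := List.length_pos_iff.2 hne
  rw [he, show ω.length = 1 by omega]
  simp [alternatingFrom]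

theorem weakCovBy_simple_iff {i : B} {u : W} : cs.WeakCovBy u (cs.simple i) ↔ u = 1 := by
  rw [weakCovBy_iff]
  constructor
  · rintro ⟨j, hj, rfl⟩
    rw [IsRightDescent, length_simple, Nat.lt_one_iff] at hj
    exact cs.length_eq_zero_iff.1 hj
  · rintro rfl
    exact ⟨i, by simp [IsRightDescent], by simp⟩

theorem weakCovBy_alternatingFrom {a b : B} {k : ℕ}
    (h : cs.IsReduced (alternatingFrom a b (k + 1))) :
    cs.WeakCovBy (cs.wordProd (alternatingFrom a b k))
      (cs.wordProd (alternatingFrom a b (k + 1))) := by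
  have hr : cs.IsReduced (alternatingFrom a b k) := by
    have := h.take k
    rwa [alternatingFrom_add a b k 1, List.take_left' (length_alternatingFrom a b k)] at this
  rw [weakCovBy_iff]
  obtain ⟨x, hx⟩ : ∃ x, alternatingFrom a b (k + 1) = alternatingFrom a b k ++ [x] := by
    rw [alternatingFrom_add a b k 1]
    by_cases hk : Even k
    · exact ⟨a, by simp [hk, alternatingFrom]⟩
    · exact ⟨b, by simp [hk, alternatingFrom]⟩
  have he : cs.wordProd (alternatingFrom a b k) =
      cs.wordProd (alternatingFrom a b (k + 1)) * cs.simple x := by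
    rw [hx, wordProd_append, wordProd_singleton, simple_mul_simple_cancel_right]
  refine ⟨x, ?_, he⟩
  rw [IsRightDescent, ← he, hr.eq, h.eq, length_alternatingFrom, length_alternatingFrom]
  exact Nat.lt_succ_self k

/-- Only the last letter is a descent: appending the other one gives an alternating word that is
still reduced, as `k + 2 ≤ M a b`. -/
theorem weakCovBy_alternatingFrom_iff {a b : B} {k : ℕ} {u : W} (hk : k + 1 < M a b) :
    cs.WeakCovBy u (cs.wordProd (alternatingFrom a b (k + 1))) ↔
      u = cs.wordProd (alternatingFrom a b k) := by
  refine ⟨fun h => ?_, fun h => h ▸ cs.weakCovBy_alternatingFrom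
    (cs.isReduced_alternatingFrom hk.le)⟩
  obtain ⟨i, hi, rfl⟩ := cs.weakCovBy_iff.1 h
  have hiab : i = a ∨ i = b := cs.mem_of_isRightDescent (cs.wordProd_alternatingFrom_mem a b _) hi
  have hr := cs.isReduced_alternatingFrom (show k + 1 ≤ M a b from hk.le)
  have hr2 := cs.isReduced_alternatingFrom (show k + 1 + 1 ≤ M a b from hk)
  obtain ⟨x, y, hxy, hx, hy⟩ : ∃ x y, (i = x ∨ i = y) ∧
      alternatingFrom a b (k + 1) = alternatingFrom a b k ++ [x] ∧
      alternatingFrom a b (k + 1 + 1) = alternatingFrom a b (k + 1) ++ [y] := by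
    rw [alternatingFrom_add a b (k + 1) 1, alternatingFrom_add a b k 1]
    by_cases hk : Even k
    · exact ⟨a, b, hiab, by simp [hk, alternatingFrom],
        by simp [hk, Nat.even_add_one, alternatingFrom]⟩
    · exact ⟨b, a, hiab.symm, by simp [hk, alternatingFrom],
        by simp [hk, Nat.even_add_one, alternatingFrom]⟩
  rcases hxy with rfl | rfl
  · rw [hx, wordProd_append, wordProd_singleton, simple_mul_simple_cancel_right]
  · rw [IsRightDescent, ← wordProd_singleton, ← wordProd_append, ← hy, hr2.eq, hr.eq,
      length_alternatingFrom, length_alternatingFrom] at hi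
    omega

theorem contracts_iff_of_forall_weakCovBy_iff {Θ : Setoid W} {w v : W}
    (h : ∀ u, cs.WeakCovBy u w ↔ u = v) : cs.Contracts Θ w ↔ Θ v w := by
  simp [Contracts, h]

/-! ### Dihedral parabolic subgroups of a finite Coxeter group. -/

section Finite

variable [Finite W]

theorem coxeterMatrix_ne_zero (cs : CoxeterSystem M W) (a b : B) : M a b ≠ 0 := by
  rw [← cs.orderOf_simple_mul_simple a b]
  exact (orderOf_pos _).ne'

theorem length_longestIn_pair (a b : B) : cs.length (cs.longestIn {a, b}) = M a b := by
  refine le_antisymm ?_ ?_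
  · obtain ⟨ω, hr, hω, he⟩ := cs.exists_isReduced_of_mem_parabolic (cs.longestIn_spec {a, b}).1
    rw [he, hr.eq]
    rcases cs.eq_alternatingFrom_of_isReduced hr hω with h | h
    · exact cs.le_of_isReduced_alternatingFrom (cs.coxeterMatrix_ne_zero a b) (h ▸ hr)
    · rw [M.symmetric a b]
      exact cs.le_of_isReduced_alternatingFrom (cs.coxeterMatrix_ne_zero b a) (h ▸ hr)
  · have := (cs.longestIn_spec {a, b}).2 _ (cs.wordProd_alternatingFrom_mem a b (M a b))
    rwa [(cs.isReduced_alternatingFrom le_rfl).eq, length_alternatingFrom] at this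

theorem longestIn_pair (a b : B) :
    cs.longestIn {a, b} = cs.wordProd (alternatingFrom a b (M a b)) := by
  have h := cs.length_mul_longestIn (cs.wordProd_alternatingFrom_mem a b (M a b))
  rw [(cs.isReduced_alternatingFrom le_rfl).eq, length_alternatingFrom, length_longestIn_pair,
    Nat.add_eq_right, length_eq_zero_iff] at h
  rw [eq_inv_of_mul_eq_one_left h, inv_longestIn]

/-- The longest element has two alternating spellings; the parity of `j` selects the one that begins
with the reverse of the given word, which then cancels. -/
theorem wordProd_alternatingFrom_mul_longestIn {a b : B} {j k : ℕ} (h : j + k = M a b) :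
    cs.wordProd (alternatingFrom a b j) * cs.longestIn {a, b} =
      cs.wordProd (alternatingFrom b a k) := by
  rw [← eq_inv_mul_iff_mul_eq, ← wordProd_reverse, alternatingFrom_reverse, ← wordProd_append]
  by_cases hj : Even j
  · rw [Set.pair_comm, longestIn_pair, M.symmetric, ← h, alternatingFrom_add]
    simp [hj]
  · rw [longestIn_pair, ← h, alternatingFrom_add]
    simp [hj]

theorem not_weakJoinIrreducible_longestIn {K : Set B} {a b : B} (ha : a ∈ K) (hb : b ∈ K)
    (hab : a ≠ b) : ¬ cs.WeakJoinIrreducible (cs.longestIn K) := by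
  intro h
  have key {i : B} (hi : i ∈ K) :
      cs.WeakCovBy (cs.longestIn K * cs.simple i) (cs.longestIn K) :=
    cs.weakCovBy_iff.2 ⟨i, (cs.isRightInversion_simple_iff_isRightDescent _ i).1
      (cs.isRightInversion_longestIn (cs.isReflection_simple i) (cs.simple_mem_parabolic hi)), rfl⟩
  exact hab (cs.simple_injective (mul_left_cancel (h.unique (key ha) (key hb))))

/-! ### The antipodal congruence -/

theorem weakLE_antipode_iff {u w : W} :
    cs.WeakLE (u * cs.longest⁻¹) (w * cs.longest⁻¹) ↔ cs.WeakLE w u := by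
  rw [inv_longest, weakLE_mul_longest_iff]

theorem weakLE_antipode_comm {u w : W} :
    cs.WeakLE (u * cs.longest⁻¹) w ↔ cs.WeakLE (w * cs.longest⁻¹) u := by
  rw [← cs.weakLE_antipode_iff (u := u)]
  simp [mul_assoc, inv_longest, longest_mul_self]

theorem weakLE_antipode_comm' {u w : W} :
    cs.WeakLE w (u * cs.longest⁻¹) ↔ cs.WeakLE u (w * cs.longest⁻¹) := by
  rw [← cs.weakLE_antipode_iff (w := u)]
  simp [mul_assoc, inv_longest, longest_mul_self]

theorem IsWeakJoin.antipode {cs : CoxeterSystem M W} {a b j : W} (h : cs.IsWeakJoin a b j) :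
    cs.IsWeakMeet (a * cs.longest⁻¹) (b * cs.longest⁻¹) (j * cs.longest⁻¹) := by
  rw [isWeakJoin_iff] at h
  refine cs.isWeakMeet_iff.2 ⟨cs.weakLE_antipode_iff.2 h.1, cs.weakLE_antipode_iff.2 h.2.1,
    fun c h1 h2 => ?_⟩
  rw [weakLE_antipode_comm'] at h1 h2 ⊢
  exact h.2.2 _ h1 h2

theorem IsWeakMeet.antipode {cs : CoxeterSystem M W} {a b m : W} (h : cs.IsWeakMeet a b m) :
    cs.IsWeakJoin (a * cs.longest⁻¹) (b * cs.longest⁻¹) (m * cs.longest⁻¹) := by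
  rw [isWeakMeet_iff] at h
  refine cs.isWeakJoin_iff.2 ⟨cs.weakLE_antipode_iff.2 h.1, cs.weakLE_antipode_iff.2 h.2.1,
    fun c h1 h2 => ?_⟩
  rw [weakLE_antipode_comm] at h1 h2 ⊢
  exact h.2.2 _ h1 h2

theorem IsWeakCongruence.antipodal {cs : CoxeterSystem M W} {Θ : Setoid W}
    (hΘ : cs.IsWeakCongruence Θ) : cs.IsWeakCongruence (cs.antipodal Θ) where
  join _ _ _ _ _ _ ha hb h₁ h₂ := hΘ.meet _ _ _ _ _ _ ha hb h₁.antipode h₂.antipode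
  meet _ _ _ _ _ _ ha hb h₁ h₂ := hΘ.join _ _ _ _ _ _ ha hb h₁.antipode h₂.antipode

/-- On `W_K`, the antipodal congruence is governed by right multiplication by `(w₀)_K`. -/
theorem IsWeakCongruence.antipodal_mul_longestIn_iff {cs : CoxeterSystem M W} {Θ : Setoid W}
    (hΘ : cs.IsWeakCongruence Θ) {K : Set B} {g h : W} (hg : g ∈ cs.parabolic K)
    (hh : h ∈ cs.parabolic K) :
    cs.antipodal Θ (g * cs.longestIn K) (h * cs.longestIn K) ↔ Θ g h := by
  change Θ (g * cs.longestIn K * cs.longest⁻¹) (h * cs.longestIn K * cs.longest⁻¹) ↔ _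
  rw [inv_longest, mul_assoc, mul_assoc]
  -- Meeting with `(w₀)_K` descends to `W_K`; joining with `(w₀)_K w₀` climbs back.
  exact ⟨fun H => hΘ.meet _ _ _ _ _ _ H (Θ.refl _) (cs.isWeakMeet_mul_longestIn_mul_longest hg)
      (cs.isWeakMeet_mul_longestIn_mul_longest hh),
    fun H => hΘ.join _ _ _ _ _ _ H (Θ.refl _) (cs.isWeakJoin_mul_longestIn_mul_longest hg)
      (cs.isWeakJoin_mul_longestIn_mul_longest hh)⟩

theorem IsWeakCongruence.contracts_simple_iff {cs : CoxeterSystem M W} {Θ : Setoid W}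
    (hΘ : cs.IsWeakCongruence Θ) (i : B) :
    cs.Contracts Θ (cs.simple i) ↔ cs.Contracts (cs.antipodal Θ) (cs.simple i) := by
  -- The rank-one subgroup is treated as the dihedral case with `M i i = 1`.
  have hl : cs.longestIn {i, i} = cs.simple i := by
    rw [longestIn_pair, M.diagonal]
    simp [alternatingFrom]
  have h := hΘ.antipodal_mul_longestIn_iff (K := {i, i}) (cs.simple_mem_parabolic (i := i) (by simp))
    (one_mem _)
  rw [hl, simple_mul_simple_self, one_mul] at h
  rw [cs.contracts_iff_of_forall_weakCovBy_iff fun u => cs.weakCovBy_simple_iff,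
    cs.contracts_iff_of_forall_weakCovBy_iff fun u => cs.weakCovBy_simple_iff, h]
  exact ⟨Θ.symm, Θ.symm⟩

theorem IsWeakCongruence.contracts_alternatingFrom_iff {cs : CoxeterSystem M W} {Θ : Setoid W}
    (hΘ : cs.IsWeakCongruence Θ) {a b : B} {j k : ℕ} (hj : 1 ≤ j) (hk : 1 ≤ k)
    (h : j + k + 1 = M a b) :
    cs.Contracts Θ (cs.wordProd (alternatingFrom a b (j + 1))) ↔
      cs.Contracts (cs.antipodal Θ) (cs.wordProd (alternatingFrom b a (k + 1))) := by
  have hba : k + 1 < M b a := by rw [M.symmetric]; omega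
  have hmem (n : ℕ) := cs.wordProd_alternatingFrom_mem a b n
  rw [cs.contracts_iff_of_forall_weakCovBy_iff
      fun u => cs.weakCovBy_alternatingFrom_iff (by omega),
    cs.contracts_iff_of_forall_weakCovBy_iff fun u => cs.weakCovBy_alternatingFrom_iff hba,
    ← cs.wordProd_alternatingFrom_mul_longestIn (show j + (k + 1) = M a b by omega),
    ← cs.wordProd_alternatingFrom_mul_longestIn (show j + 1 + k = M a b by omega),
    hΘ.antipodal_mul_longestIn_iff (hmem _) (hmem _)]
  exact ⟨Θ.symm, Θ.symm⟩

end Finite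

end CoxeterSystem

theorem proposition6p13 {B W : Type*} [Group W] [Finite W] {M : CoxeterMatrix B}
    (cs : CoxeterSystem M W) (Θ : Setoid W) (hΘ : cs.IsWeakCongruence Θ) :
    cs.IsWeakCongruence (cs.antipodal Θ) ∧
    (∀ s : W, cs.WeakJoinIrreducible s → cs.degree s = 1 →
      (cs.Contracts Θ s ↔ cs.Contracts (cs.antipodal Θ) s)) ∧
    (∀ (r s : B) (k : ℕ) (γ γ' : W) (hγ : cs.WeakJoinIrreducible γ), cs.degree γ = 2 →
      cs.IsReduced (alternatingFrom s r k) → γ = cs.wordProd (alternatingFrom s r k) →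
      γ' = cs.lowerCover γ hγ * cs.longestIn {r, s} →
        cs.WeakJoinIrreducible γ' ∧ cs.degree γ' = 2 ∧
        (∃ k' : ℕ, cs.IsReduced (alternatingFrom r s k') ∧
          γ' = cs.wordProd (alternatingFrom r s k')) ∧
        (cs.length γ' : ℤ) = M r s - cs.length γ + 1 ∧
        (cs.Contracts Θ γ ↔ cs.Contracts (cs.antipodal Θ) γ')) := by
  refine ⟨hΘ.antipodal, ?_, ?_⟩
  · intro s _ hs
    obtain ⟨i, rfl⟩ := cs.exists_eq_simple_of_degree_eq_one hs
    exact hΘ.contracts_simple_iff i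
  · rintro r s k γ γ' hγ hdeg hred rfl hγ'
    obtain ⟨hsr, hk2⟩ := (cs.degree_alternatingFrom_eq_two_iff hred).1 hdeg
    have hle := cs.le_of_isReduced_alternatingFrom (cs.coxeterMatrix_ne_zero s r) hred
    -- At `k = M s r` the element is `(w₀)_{s,r}`, which covers two elements.
    have hne : k ≠ M s r := by
      rintro rfl
      rw [← cs.longestIn_pair] at hγ
      exact cs.not_weakJoinIrreducible_longestIn (a := s) (b := r) (by simp) (by simp) hsr hγ
    obtain ⟨j, rfl⟩ : ∃ j, k = j + 1 := ⟨k - 1, by omega⟩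
    -- Here `j` is the length of `γ_*`, and `n + 1` will be the length of `γ'`.
    obtain ⟨n, hn⟩ : ∃ n, j + n + 1 = M s r := ⟨M s r - j - 1, by omega⟩
    have hrs : n + 1 < M r s := by rw [M.symmetric]; omega
    have hlow : cs.lowerCover _ hγ = cs.wordProd (alternatingFrom s r j) :=
      (cs.weakCovBy_alternatingFrom_iff (by omega)).1 (cs.lowerCover_weakCovBy _ hγ)
    rw [hlow, Set.pair_comm, cs.wordProd_alternatingFrom_mul_longestIn (k := n + 1) (by omega)] at hγ'
    subst hγ'
    have hred' := cs.isReduced_alternatingFrom hrs.le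
    refine ⟨⟨_, (cs.weakCovBy_alternatingFrom_iff hrs).2 rfl,
        fun u => (cs.weakCovBy_alternatingFrom_iff hrs).1⟩,
      (cs.degree_alternatingFrom_eq_two_iff hred').2 ⟨hsr.symm, by omega⟩, ⟨n + 1, hred', rfl⟩, ?_,
      hΘ.contracts_alternatingFrom_iff (by omega) (by omega) hn⟩
    rw [hred'.eq, hred.eq, CoxeterSystem.length_alternatingFrom,
      CoxeterSystem.length_alternatingFrom, M.symmetric r s, ← hn]
    push_cast
    ring
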